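/- Let $n\ge 1$, let $\mathbb{Z}_+=\{0,1,2,\dots\}$, let $\mathbb{T}=\{z\in\mathbb{C}:|z|=1\}$ and $\overline{\mathbb{D}}=\{v\in\mathbb{C}:|v|\le 1\}$. For $w\in\overline{\mathbb{D}}$ and $z\in\mathbb{T}$ let $\Psi^{w}_{z}:\overline{\mathbb{D}}\to\overline{\mathbb{D}}$ be $$\Psi^{w}_{z}(v)=z\,\frac{v+w}{1+\overline{w}v},$$ understood as the constant function $\Psi^w_z(v)=zw$ if $|w|=1$. For $w\in\overline{\mathbb{D}}^n$ and $z\in\mathbb{T}^n$ put $$\Psi(w,z)=\Psi^{w_1}_{z_1}\circ\cdots\circ\Psi^{w_n}_{z_n}(0).$$ For $(p,q)\in\mathbb{Z}^2$ define the real polynomial $f^{(p,q)}$ as follows. If $\min\{p,q\}\ge 1$, set $m=|p-q|$, $\nu=\min\{p,q\}-1$ and $$f^{(p,q)}(x)=\frac{(-1)^{q+\nu+1}}{q}(1-x^2)\,x^m\sum_{j=0}^{\nu}(-1)^j\frac{(j+\nu+m+1)!}{j!\,(j+m)!\,(\nu-j)!}\,x^{2j};$$ if $p\ge 0$, set $f^{(p,0)}(x)=x^p$;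 and if $\min\{p,q\}<0$ or $p=0<q$, set $f^{(p,q)}=0$. **Theorem.** For every $r\in[-1,1]^n$ and every $z\in\mathbb{T}^n$, $$\Psi(r,z)=\sum_{k\in\{1\}\times\mathbb{Z}_+^{n-1}}\Bigl(\prod_{j=1}^{n}f^{(k_j,k_{j+1})}(r_j)\Bigr)z^k,$$ where $k_{n+1}=0$, $z^k=z_1^{k_1}\cdots z_n^{k_n}$, and the series converges absolutely. -/

import Mathlib

open scoped Nat

noncomputable section

namespace DiskComposition

/-- The linear fractional transformation `v ↦ z (v + w) / (1 + conj w * v)` of the closed unit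
disk. When `w` lies on the unit circle it is the constant function `z w`, to which the fraction
reduces wherever its denominator does not vanish. -/
def diskMap (w z v : ℂ) : ℂ :=
  if ‖w‖ = 1 then z * w else z * ((v + w) / (1 + starRingEnd ℂ w * v))

/-- The composition `diskMap (w 1) (z 1) ∘ ⋯ ∘ diskMap (w n) (z n)`. -/
def diskComp : (n : ℕ) → (Fin n → ℂ) → (Fin n → ℂ) → ℂ → ℂ
  | 0, _, _ => id
  | n + 1, w, z => diskMap (w 0) (z 0) ∘ diskComp n (fun j => w j.succ) (fun j => z j.succ)

/-- `Ψ(w, z)`: the value at `0` of the `n`-fold composition. -/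
def Psi {n : ℕ} (w z : Fin n → ℂ) : ℂ := diskComp n w z 0

/-- The real polynomial functions `f^{(p,q)}`, for integers `p, q`. In the first case
`m = |p - q|` and `ν = min p q - 1` are natural numbers. -/
def scatPoly (p q : ℤ) (x : ℝ) : ℝ :=
  if 1 ≤ min p q then
    let m : ℕ := (p - q).natAbs
    let ν : ℕ := (min p q - 1).toNat
    (-1 : ℝ) ^ (q.toNat + ν + 1) / (q : ℝ) * (1 - x ^ 2) * x ^ m *
      ∑ j ∈ Finset.range (ν + 1),
        (-1 : ℝ) ^ j * (((j + ν + m + 1)! : ℕ) : ℝ) /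
          (((j ! : ℕ) : ℝ) * (((j + m)! : ℕ) : ℝ) * (((ν - j)! : ℕ) : ℝ)) * x ^ (2 * j)
  else if 0 ≤ p ∧ q = 0 then x ^ p.toNat
  else 0

/-- The entry `k_{j+1}` of a tuple, interpreted as zero beyond the last index. -/
def nextEntry {n : ℕ} (k : Fin n → ℕ) (j : Fin n) : ℕ :=
  if h : (j : ℕ) + 1 < n then k ⟨(j : ℕ) + 1, h⟩ else 0

end DiskComposition

end

/-! For `|r| < 1`, `f^{(p,q)}(r)` is the coefficient of `v ^ q` in `((v + r) / (1 + r v)) ^ p`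
(`hasSum_scatPoly_mul_pow`). Substituting for `v` the composition of the remaining maps and
expanding each `v ^ q` recursively gives the series for every power `Psi ^ p` (`hasSum_scatTerm`);
the theorem is `p = 1`. The difficulty is absolute convergence of the multiple series. Cauchy's
estimate on a circle of radius `R > 1` gives `|f^{(p,q)}(r)| ≤ M ^ p / R ^ q` with `M > 1` as close
to 1 as desired (`exists_abs_scatPoly_le`), so the decay in `q` absorbs the growth of the inner sums
(`summable_norm_scatTerm`). -/

namespace DiskComposition

/-! ### The polynomials as Taylor coefficients -/

/-- The coefficient of `x ^ (m + 2 l)` in `f^{(p,q)}` up to sign, where `min p q = μ` and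
`|p - q| = m`, divided by `p`. -/
noncomputable def scatCoeff (μ m l : ℕ) : ℝ :=
  (-1) ^ l * ((l + μ + m - 1)! : ℝ) / ((l ! : ℝ) * ((l + m)! : ℝ) * ((μ - l)! : ℝ))

/-- Multiplying by `1 - y` merges neighbouring coefficients. Truncating at `K` makes this an
induction; the subtracted term is the one not yet merged. -/
theorem one_sub_mul_sum_eq_partial (ν m : ℕ) (y : ℝ) (K : ℕ) (hK : K ≤ ν) :
    (1 - y) * ∑ j ∈ Finset.range (K + 1),
      (-1 : ℝ) ^ j * (((j + ν + m + 1)! : ℕ) : ℝ) /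
        (((j ! : ℕ) : ℝ) * (((j + m)! : ℕ) : ℝ) * (((ν - j)! : ℕ) : ℝ)) * y ^ j =
    ((ν + 1) * (ν + 1 + m) : ℝ) *
        ∑ l ∈ Finset.range (K + 1), scatCoeff (ν + 1) m l * y ^ l -
      (-1 : ℝ) ^ K * (((K + ν + m + 1)! : ℕ) : ℝ) /
        (((K ! : ℕ) : ℝ) * (((K + m)! : ℕ) : ℝ) * (((ν - K)! : ℕ) : ℝ)) * y ^ (K + 1) := by
  induction K with
  | zero =>
    simp only [zero_add, Finset.sum_range_one, scatCoeff]
    have h1 : ν + 1 + m - 1 = ν + m := by omega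
    rw [h1, Nat.sub_zero, Nat.sub_zero, Nat.factorial_succ (ν + m), Nat.factorial_succ ν]
    push_cast
    field_simp
    ring
  | succ K ih =>
    rw [Finset.sum_range_succ, mul_add, ih (by omega), Finset.sum_range_succ _ (K + 1)]
    obtain ⟨a, rfl⟩ : ∃ a, ν = K + 1 + a := ⟨ν - (K + 1), by omega⟩
    simp only [scatCoeff]
    have h1 : K + 1 + a - K = a + 1 := by omega
    have h2 : K + 1 + a - (K + 1) = a := by omega
    have h3 : K + 1 + a + 1 - (K + 1) = a + 1 := by omega
    have h4 : K + 1 + (K + 1 + a + 1) + m - 1 = K + (K + 1 + a) + m + 1 := by omega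
    have h5 : K + 1 + (K + 1 + a) + m + 1 = (K + (K + 1 + a) + m + 1) + 1 := by omega
    have h6 : K + 1 + m = (K + m) + 1 := by omega
    rw [h1, h2, h3, h4, h5, h6, Nat.factorial_succ (K + (K + 1 + a) + m + 1),
      Nat.factorial_succ a, Nat.factorial_succ (K + m), Nat.factorial_succ K]
    push_cast
    field_simp
    ring

/-- At `K = ν` the leftover term is exactly the top summand `l = ν + 1`. -/
theorem one_sub_mul_sum_eq (ν m : ℕ) (y : ℝ) :
    (1 - y) * ∑ j ∈ Finset.range (ν + 1),
      (-1 : ℝ) ^ j * (((j + ν + m + 1)! : ℕ) : ℝ) /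
        (((j ! : ℕ) : ℝ) * (((j + m)! : ℕ) : ℝ) * (((ν - j)! : ℕ) : ℝ)) * y ^ j =
    ((ν + 1) * (ν + 1 + m) : ℝ) *
        ∑ l ∈ Finset.range (ν + 2), scatCoeff (ν + 1) m l * y ^ l := by
  rw [one_sub_mul_sum_eq_partial ν m y ν le_rfl, Finset.sum_range_succ _ (ν + 1)]
  simp only [scatCoeff]
  have h1 : ν + 1 + (ν + 1) + m - 1 = ν + ν + m + 1 := by omega
  have h2 : ν + 1 + m = (ν + m) + 1 := by omega
  rw [h1, h2, Nat.factorial_succ (ν + m), Nat.factorial_succ ν, Nat.sub_self, Nat.sub_self]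
  push_cast
  field_simp
  ring

theorem scatPoly_of_ge (μ m : ℕ) (hμ : 1 ≤ μ) (x : ℝ) :
    scatPoly ((μ + m : ℕ) : ℤ) (μ : ℤ) x =
      (μ + m) * ∑ l ∈ Finset.range (μ + 1), scatCoeff μ m l * x ^ (m + 2 * l) := by
  obtain ⟨ν, rfl⟩ : ∃ ν, μ = ν + 1 := ⟨μ - 1, by omega⟩
  have hmin : min (((ν + 1 + m : ℕ) : ℤ)) ((ν + 1 : ℕ) : ℤ) = ((ν + 1 : ℕ) : ℤ) := by omega
  have hm : (((ν + 1 + m : ℕ) : ℤ) - ((ν + 1 : ℕ) : ℤ)).natAbs = m := by omega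
  have hν : (((ν + 1 : ℕ) : ℤ) - 1).toNat = ν := by omega
  have hs : (-1 : ℝ) ^ (ν + 1 + ν + 1) = 1 := Even.neg_one_pow ⟨ν + 1, by omega⟩
  rw [scatPoly, hmin, if_pos (by omega)]
  simp only [hm, hν, Int.toNat_natCast, hs]
  have := one_sub_mul_sum_eq ν m (x ^ 2)
  simp only [← pow_mul] at this
  calc _ = 1 / ((ν + 1 : ℕ) : ℝ) * x ^ m * _ * _ := by
        push_cast
        rw [mul_right_comm (1 / ((ν : ℝ) + 1))]
    _ = _ := by
        rw [mul_assoc, this]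
        simp only [pow_add x m, mul_left_comm _ (x ^ m), ← Finset.mul_sum]
        push_cast
        field_simp

theorem scatPoly_of_le (μ m : ℕ) (hμ : 1 ≤ μ) (x : ℝ) :
    scatPoly (μ : ℤ) ((μ + m : ℕ) : ℤ) x =
      (-1) ^ m * μ * ∑ l ∈ Finset.range (μ + 1), scatCoeff μ m l * x ^ (m + 2 * l) := by
  obtain ⟨ν, rfl⟩ : ∃ ν, μ = ν + 1 := ⟨μ - 1, by omega⟩
  have hmin : min ((ν + 1 : ℕ) : ℤ) (((ν + 1 + m : ℕ) : ℤ)) = ((ν + 1 : ℕ) : ℤ) := by omega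
  have hm : (((ν + 1 : ℕ) : ℤ) - ((ν + 1 + m : ℕ) : ℤ)).natAbs = m := by omega
  have hν : (((ν + 1 : ℕ) : ℤ) - 1).toNat = ν := by omega
  have hs : (-1 : ℝ) ^ (ν + 1 + m + ν + 1) = (-1) ^ m := by
    rw [show ν + 1 + m + ν + 1 = 2 * (ν + 1) + m by omega, pow_add, pow_mul]
    simp
  rw [scatPoly, hmin, if_pos (by omega)]
  simp only [hm, hν, Int.toNat_natCast, hs]
  have := one_sub_mul_sum_eq ν m (x ^ 2)
  simp only [← pow_mul] at this
  calc _ = (-1) ^ m / (((ν + 1 + m : ℕ) : ℤ) : ℝ) * x ^ m * _ * _ := by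
        rw [mul_right_comm ((-1) ^ m / (((ν + 1 + m : ℕ) : ℤ) : ℝ))]
    _ = _ := by
        rw [mul_assoc, this]
        simp only [pow_add x m, mul_left_comm _ (x ^ m), ← Finset.mul_sum]
        push_cast
        field_simp

theorem scatPoly_zero_right (p : ℕ) (x : ℝ) : scatPoly (p : ℤ) 0 x = x ^ p := by
  rw [scatPoly, if_neg (by omega), if_pos (by omega), Int.toNat_natCast]

theorem scatPoly_zero_left (q : ℕ) (hq : q ≠ 0) (x : ℝ) : scatPoly 0 (q : ℤ) x = 0 := by
  rw [scatPoly, if_neg (by omega), if_neg (by omega)]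

/-- `f^{(p,q)}` as the Cauchy product of the expansions of `(v + x) ^ p` and
`(1 + x v) ^ (-p)`. -/
theorem scatPoly_eq_sum_antidiagonal (p q : ℕ) (hp : 1 ≤ p) (x : ℝ) :
    scatPoly (p : ℤ) (q : ℤ) x =
      ∑ ij ∈ Finset.HasAntidiagonal.antidiagonal q,
        (x ^ (p - ij.1) * (p.choose ij.1 : ℝ)) *
          (((ij.2 + (p - 1)).choose (p - 1) : ℝ) * (-x) ^ ij.2) := by
  rcases Nat.eq_zero_or_pos q with rfl | hq
  · simp [scatPoly_zero_right]
  rw [← Finset.Nat.sum_antidiagonal_swap, Finset.Nat.sum_antidiagonal_eq_sum_range_succ_mk]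
  simp only [Prod.fst_swap, Prod.snd_swap]
  rcases le_total q p with h | h
  · obtain ⟨m, rfl⟩ := Nat.exists_eq_add_of_le h
    rw [scatPoly_of_ge q m hq, Finset.mul_sum]
    refine Finset.sum_congr rfl fun l hl => ?_
    obtain ⟨a, rfl⟩ : ∃ a, q = l + a := ⟨q - l, by grind⟩
    rw [Nat.cast_choose ℝ (show l + a - l ≤ l + a + m by omega),
      Nat.cast_choose ℝ (show l + a + m - 1 ≤ l + (l + a + m - 1) by omega), scatCoeff]
    have h1 : l + a - l = a := by omega
    have h2 : l + a + m - a = l + m := by omega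
    have h3 : l + (l + a + m - 1) - (l + a + m - 1) = l := by omega
    have h4 : l + (l + a + m - 1) = l + (l + a) + m - 1 := by omega
    rw [h1, h2, h3, h4, ← Nat.mul_factorial_pred (show l + a + m ≠ 0 by omega), neg_pow x,
      show x ^ (m + 2 * l) = x ^ (l + m) * x ^ l by ring]
    push_cast
    field_simp
  · obtain ⟨m, rfl⟩ := Nat.exists_eq_add_of_le h
    -- The first `m` summands vanish: their binomial `p.choose (p + m - j)` has lower index above
    -- `p`.
    rw [scatPoly_of_le p m hp, Finset.mul_sum, show (p + m).succ = m + (p + 1) by omega,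
      Finset.sum_range_add _ m (p + 1), Finset.sum_eq_zero (s := Finset.range m), zero_add]
    · refine Finset.sum_congr rfl fun l hl => ?_
      obtain ⟨a, rfl⟩ : ∃ a, p = l + a := ⟨p - l, by grind⟩
      have h1 : l + a + m - (m + l) = a := by omega
      rw [h1, Nat.cast_choose ℝ (show a ≤ l + a by omega),
        Nat.cast_choose ℝ (show l + a - 1 ≤ m + l + (l + a - 1) by omega), scatCoeff]
      have h2 : l + a - a = l := by omega
      have h3 : m + l + (l + a - 1) - (l + a - 1) = l + m := by omega
      have h4 : m + l + (l + a - 1) = l + (l + a) + m - 1 := by omega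
      have h5 : l + a - l = a := by omega
      rw [h2, h3, h4, h5, ← Nat.mul_factorial_pred (show l + a ≠ 0 by omega), neg_pow x,
        show x ^ (m + 2 * l) = x ^ (m + l) * x ^ l by ring, pow_add (-1 : ℝ) m l]
      push_cast
      field_simp
    · intro j hj
      rw [Nat.choose_eq_zero_of_lt (by grind)]
      simp

/-- The power series expansion of `((v + r) / (1 + r v)) ^ p`. -/
theorem hasSum_scatPoly_mul_pow (p : ℕ) (r : ℝ) (v : ℂ) (hv : ‖(r : ℂ) * v‖ < 1) :
    HasSum (fun q : ℕ => (scatPoly p q r : ℂ) * v ^ q) (((v + r) / (1 + r * v)) ^ p) := by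
  rcases Nat.eq_zero_or_pos p with rfl | hp
  · have := hasSum_single (f := fun q : ℕ => (scatPoly (0 : ℕ) q r : ℂ) * v ^ q) 0
      (fun q hq => by simp [scatPoly_zero_left q hq])
    have h0 := scatPoly_zero_right 0 r
    simp only [Nat.cast_zero, pow_zero] at h0
    simpa [h0] using this
  have h1 : HasSum (fun i : ℕ => v ^ i * (r : ℂ) ^ (p - i) * (p.choose i : ℂ)) ((v + r) ^ p) := by
    rw [add_pow]
    refine hasSum_sum_of_ne_finset_zero fun i hi => ?_
    rw [Nat.choose_eq_zero_of_lt (by grind)]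
    simp
  have h1n : Summable fun i : ℕ => ‖v ^ i * (r : ℂ) ^ (p - i) * (p.choose i : ℂ)‖ :=
    summable_of_ne_finset_zero (s := Finset.range (p + 1)) fun i hi => by
      rw [Nat.choose_eq_zero_of_lt (by grind)]
      simp
  have hv' : ‖-((r : ℂ) * v)‖ < 1 := by rwa [norm_neg]
  have h2 := hasSum_choose_mul_geometric_of_norm_lt_one (p - 1) hv'
  rw [sub_neg_eq_add, Nat.sub_add_cancel hp] at h2
  have h2n := summable_norm_iff.2 h2.summable
  have h3 := (summable_norm_sum_mul_antidiagonal_of_summable_norm h1n h2n).of_norm.hasSum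
  rw [← tsum_mul_tsum_eq_tsum_sum_antidiagonal_of_summable_norm h1n h2n, h1.tsum_eq, h2.tsum_eq,
    ← div_eq_mul_one_div, ← div_pow] at h3
  suffices h : ∀ q : ℕ, (scatPoly p q r : ℂ) * v ^ q = _ from (funext h) ▸ h3
  intro q
  rw [scatPoly_eq_sum_antidiagonal p q hp]
  push_cast
  rw [Finset.sum_mul]
  refine Finset.sum_congr rfl fun ij hij => ?_
  rw [← Finset.HasAntidiagonal.mem_antidiagonal.1 hij, pow_add, neg_mul_eq_neg_mul,
    mul_pow (-(r : ℂ))]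
  ring

/-! ### Geometric decay of the coefficients -/

/-- Cauchy's estimate for the coefficients of a power series. -/
theorem norm_coeff_le_of_hasSum {c : ℕ → ℂ} {f : ℂ → ℂ} {R M : ℝ} (hR : 0 < R)
    (hf : DifferentiableOn ℂ f (Metric.closedBall 0 R))
    (hsum : ∀ v : ℂ, ‖v‖ ≤ R → HasSum (fun q => c q * v ^ q) (f v))
    (hM : ∀ v : ℂ, ‖v‖ ≤ R → ‖f v‖ ≤ M) (q : ℕ) : ‖c q‖ ≤ M / R ^ q := by
  lift R to NNReal using hR.le
  have hR' : 0 < R := by exact_mod_cast hR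
  have h1 : HasFPowerSeriesOnBall f (FormalMultilinearSeries.ofScalars ℂ c) 0 R := by
    refine ⟨?_, by exact_mod_cast hR', ?_⟩
    · refine FormalMultilinearSeries.le_radius_of_summable_norm _ ?_
      have := summable_norm_iff.2 (hsum (R : ℂ) (by simp)).summable
      simpa [FormalMultilinearSeries.ofScalars_norm] using this
    · intro y hy
      have hy' : ‖y‖ ≤ R := by
        rw [Metric.mem_eball, edist_zero_right] at hy
        have : ‖y‖₊ < R := by exact_mod_cast hy
        exact_mod_cast this.le
      have := hsum y hy'
      simpa [FormalMultilinearSeries.ofScalars_apply_eq, zero_add, mul_comm] using this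
  have h2 := h1.factorial_smul 1 q
  rw [← iteratedDeriv_eq_iteratedFDeriv] at h2
  have h3 := Complex.norm_iteratedDeriv_le_of_forall_mem_sphere_norm_le (c := 0) (C := M) q hR
    (hf.diffContOnCl_ball le_rfl)
    (fun z hz => hM z (by simpa using (mem_sphere_zero_iff_norm.1 hz).le))
  rw [← h2, FormalMultilinearSeries.ofScalars_apply_eq] at h3
  have hq : (0 : ℝ) < q ! := by positivity
  rw [nsmul_eq_mul, norm_mul, mul_div_assoc] at h3
  simpa [hq] using h3

theorem one_add_mul_ne_zero {r : ℝ} {v : ℂ} (hv : ‖(r : ℂ) * v‖ < 1) : 1 + (r : ℂ) * v ≠ 0 := by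
  intro h
  rw [← neg_eq_of_add_eq_zero_right h] at hv
  simp at hv

/-- This identity compares the disk automorphism with 1 in modulus, both inside the disk and just
outside it. -/
theorem normSq_add_sub_normSq_one_add_mul (r : ℝ) (v : ℂ) :
    ‖v + r‖ ^ 2 - ‖1 + r * v‖ ^ 2 = (‖v‖ ^ 2 - 1) * (1 - r ^ 2) := by
  simp only [← Complex.normSq_eq_norm_sq, Complex.normSq_apply]
  simp
  ring

/-- Slightly beyond the unit circle, the disk automorphism is only slightly larger than one. -/
theorem exists_radius_norm_div_le {r : ℝ} (hr : |r| < 1) {M : ℝ} (hM : 1 < M) :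
    ∃ R : ℝ, 1 < R ∧ |r| * R < 1 ∧
      ∀ v : ℂ, ‖v‖ ≤ R → ‖(v + r) / (1 + r * v)‖ ≤ M := by
  have hr2 : r ^ 2 < 1 := by rw [← sq_abs]; nlinarith [abs_nonneg r]
  have e1 : ∀ᶠ R in nhdsWithin (1 : ℝ) (Set.Ioi 1), |r| * R < 1 := by
    have : Filter.Tendsto (fun R : ℝ => |r| * R) (nhdsWithin 1 (Set.Ioi 1)) (nhds (|r| * 1)) :=
      (Continuous.tendsto (by fun_prop) 1).mono_left nhdsWithin_le_nhds
    exact this.eventually (gt_mem_nhds (by simpa using hr))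
  -- Strict at `R = 1`, hence true slightly beyond; it yields `‖v + r‖ ^ 2 ≤ M ^ 2 * ‖1 + r * v‖ ^
  -- 2`.
  have e2 : ∀ᶠ R in nhdsWithin (1 : ℝ) (Set.Ioi 1),
      (R ^ 2 - 1) * (1 - r ^ 2) - (M ^ 2 - 1) * (1 - |r| * R) ^ 2 < 0 := by
    have : Filter.Tendsto
        (fun R : ℝ => (R ^ 2 - 1) * (1 - r ^ 2) - (M ^ 2 - 1) * (1 - |r| * R) ^ 2)
        (nhdsWithin 1 (Set.Ioi 1))
        (nhds ((1 ^ 2 - 1) * (1 - r ^ 2) - (M ^ 2 - 1) * (1 - |r| * 1) ^ 2)) :=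
      (Continuous.tendsto (by fun_prop) 1).mono_left nhdsWithin_le_nhds
    refine this.eventually (gt_mem_nhds ?_)
    have h1 : 0 < M ^ 2 - 1 := by nlinarith
    have h2 : 0 < (1 - |r| * 1) ^ 2 := by
      have : 0 < 1 - |r| * 1 := by linarith
      positivity
    nlinarith [mul_pos h1 h2]
  obtain ⟨R, ⟨h1, h2⟩, hR⟩ := ((e1.and e2).and self_mem_nhdsWithin).exists
  refine ⟨R, hR, h1, fun v hv => ?_⟩
  have hR' : 1 < R := hR
  have hrv : ‖(r : ℂ) * v‖ ≤ |r| * R := by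
    rw [norm_mul, Complex.norm_real, Real.norm_eq_abs]
    gcongr
  have hden : 1 - |r| * R ≤ ‖1 + r * v‖ := by
    have := norm_sub_norm_le (1 : ℂ) (-(r * v))
    rw [norm_one, norm_neg, sub_neg_eq_add] at this
    linarith
  rw [norm_div, div_le_iff₀ (by linarith)]
  refine le_of_sq_le_sq ?_ (by have := norm_nonneg (1 + (r : ℂ) * v); nlinarith)
  have h3 : ‖v‖ ^ 2 ≤ R ^ 2 := by gcongr
  have h4 : (1 - |r| * R) ^ 2 ≤ ‖1 + r * v‖ ^ 2 := by
    have : 0 ≤ 1 - |r| * R := by linarith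
    gcongr
  have h5 := normSq_add_sub_normSq_one_add_mul r v
  have h6 : (‖v‖ ^ 2 - 1) * (1 - r ^ 2) ≤ (R ^ 2 - 1) * (1 - r ^ 2) := by gcongr
  have h7 : (M ^ 2 - 1) * (1 - |r| * R) ^ 2 ≤ (M ^ 2 - 1) * ‖1 + r * v‖ ^ 2 := by
    gcongr; nlinarith
  rw [mul_pow]
  linarith

theorem scatPoly_eq_zero_of_abs_eq_one {r : ℝ} (hr : |r| = 1) (p : ℤ) {q : ℤ} (hq : q ≠ 0) :
    scatPoly p q r = 0 := by
  have : r ^ 2 = 1 := by rw [← sq_abs, hr, one_pow]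
  rw [scatPoly]
  split_ifs with h1 h2
  · simp [this]
  · exact absurd h2.2 hq
  · rfl

/-- Geometric decay of `f^{(p,q)}(r)` in `q`, with a loss in `p` as small as desired. -/
theorem exists_abs_scatPoly_le {r : ℝ} (hr : |r| ≤ 1) {M : ℝ} (hM : 1 < M) :
    ∃ R : ℝ, 1 < R ∧ ∀ p q : ℕ, |scatPoly p q r| ≤ M ^ p / R ^ q := by
  rcases hr.lt_or_eq with hr | hr
  · obtain ⟨R, hR, hrR, hb⟩ := exists_radius_norm_div_le hr hM
    refine ⟨R, hR, fun p q => ?_⟩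
    have hv : ∀ v : ℂ, ‖v‖ ≤ R → ‖(r : ℂ) * v‖ < 1 := fun v hv => by
      rw [norm_mul, Complex.norm_real, Real.norm_eq_abs]
      exact lt_of_le_of_lt (by gcongr) hrR
    have := norm_coeff_le_of_hasSum (c := fun q => (scatPoly p q r : ℂ))
      (f := fun v => ((v + r) / (1 + r * v)) ^ p) (M := M ^ p) (R := R) (by linarith)
      (fun v h => by
        have := one_add_mul_ne_zero (hv v (by simpa using h))
        exact DifferentiableAt.differentiableWithinAt (by fun_prop (disch := assumption)))
      (fun v h => hasSum_scatPoly_mul_pow p r v (hv v h))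
      (fun v h => by
        rw [norm_pow]
        exact pow_le_pow_left₀ (norm_nonneg _) (hb v h) p) q
    rwa [Complex.norm_real] at this
  -- Only `q = 0` survives when `|r| = 1`, so any radius above 1 would do.
  · refine ⟨2, one_lt_two, fun p q => ?_⟩
    rcases Nat.eq_zero_or_pos q with rfl | hq
    · rw [Nat.cast_zero, scatPoly_zero_right, abs_pow, hr, one_pow, pow_zero, div_one]
      exact one_le_pow₀ hM.le
    · rw [scatPoly_eq_zero_of_abs_eq_one hr _ (by omega), abs_zero]
      have : 0 < M := by linarith
      positivity

/-! ### Expansion of a single disk map -/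

theorem norm_diskMap_le_one {r : ℝ} (hr : |r| ≤ 1) {z v : ℂ} (hz : ‖z‖ = 1) (hv : ‖v‖ ≤ 1) :
    ‖diskMap r z v‖ ≤ 1 := by
  rw [diskMap]
  split_ifs with h
  · rw [norm_mul, hz, h, one_mul]
  · rw [norm_mul, hz, one_mul, norm_div, Complex.conj_ofReal]
    refine div_le_one_of_le₀ (le_of_sq_le_sq ?_ (norm_nonneg _)) (norm_nonneg _)
    have h5 := normSq_add_sub_normSq_one_add_mul r v
    have h1 : ‖v‖ ^ 2 ≤ 1 := pow_le_one₀ (norm_nonneg _) hv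
    have h2 : r ^ 2 ≤ 1 := by rw [← sq_abs]; exact pow_le_one₀ (abs_nonneg _) hr
    nlinarith

theorem hasSum_diskMap_pow {r : ℝ} (hr : |r| ≤ 1) (z : ℂ) {v : ℂ} (hv : ‖v‖ ≤ 1) (p : ℕ) :
    HasSum (fun q : ℕ => (scatPoly p q r : ℂ) * z ^ p * v ^ q) (diskMap r z v ^ p) := by
  rcases hr.lt_or_eq with hr | hr
  · have h : ‖(r : ℂ) * v‖ < 1 := by
      rw [norm_mul, Complex.norm_real, Real.norm_eq_abs]
      nlinarith [abs_nonneg r, norm_nonneg v]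
    rw [diskMap, if_neg (by rw [Complex.norm_real, Real.norm_eq_abs]; exact hr.ne), mul_pow,
      Complex.conj_ofReal]
    simpa only [mul_left_comm, mul_assoc] using
      (hasSum_scatPoly_mul_pow p r v h).mul_left (z ^ p)
  · have := hasSum_single (f := fun q : ℕ => (scatPoly p q r : ℂ) * z ^ p * v ^ q) 0
      (fun q hq => by rw [scatPoly_eq_zero_of_abs_eq_one hr _ (by omega)]; simp)
    rw [Nat.cast_zero, scatPoly_zero_right] at this
    rw [diskMap, if_pos (by rw [Complex.norm_real, Real.norm_eq_abs, hr])]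
    simpa [mul_pow, mul_comm] using this

theorem norm_Psi_le_one {n : ℕ} (r : Fin n → ℝ) (hr : ∀ j, |r j| ≤ 1) (z : Fin n → ℂ)
    (hz : ∀ j, ‖z j‖ = 1) : ‖Psi (fun j => (r j : ℂ)) z‖ ≤ 1 := by
  induction n with
  | zero => simp [Psi, diskComp]
  | succ n ih =>
    exact norm_diskMap_le_one (hr 0) (hz 0)
      (ih (fun j => r j.succ) (fun j => hr _) (fun j => z j.succ) fun j => hz _)

/-! ### Expansion of the composition -/

/-- The term of index `k` in the expansion of a power of `Psi r z`. -/
noncomputable def scatTerm {n : ℕ} (r : Fin n → ℝ) (z : Fin n → ℂ) (k : Fin n → ℕ) : ℂ :=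
  ((∏ j, scatPoly (k j : ℤ) (nextEntry k j : ℤ) (r j) : ℝ) : ℂ) * ∏ j, z j ^ k j

theorem nextEntry_cons_succ {n : ℕ} (p : ℕ) (k : Fin n → ℕ) (j : Fin n) :
    nextEntry (Fin.cons p k : Fin (n + 1) → ℕ) j.succ = nextEntry k j := by
  by_cases h : (j : ℕ) + 1 < n
  · rw [nextEntry, nextEntry, dif_pos h, dif_pos (by simpa using h)]
    exact Fin.cons_succ (α := fun _ => ℕ) p k ⟨j + 1, h⟩
  · rw [nextEntry, nextEntry, dif_neg h, dif_neg (by simpa using h)]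

theorem nextEntry_cons_zero {n : ℕ} (p : ℕ) (k : Fin (n + 1) → ℕ) :
    nextEntry (Fin.cons p k : Fin (n + 2) → ℕ) 0 = k 0 := by
  rw [nextEntry, dif_pos (by simp)]
  exact Fin.cons_succ (α := fun _ => ℕ) p k 0

theorem scatTerm_cons_cons {n : ℕ} (r : Fin (n + 2) → ℝ) (z : Fin (n + 2) → ℂ) (p q : ℕ)
    (k : Fin n → ℕ) :
    scatTerm r z (Fin.cons p (Fin.cons q k : Fin (n + 1) → ℕ)) =
      (scatPoly p q (r 0) : ℂ) * z 0 ^ p *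
        scatTerm (fun j => r j.succ) (fun j => z j.succ) (Fin.cons q k) := by
  rw [scatTerm, scatTerm, Fin.prod_univ_succ, Fin.prod_univ_succ (fun j => z j ^ _)]
  simp only [nextEntry_cons_succ, nextEntry_cons_zero, Fin.cons_zero, Fin.cons_succ]
  push_cast
  ring

theorem scatTerm_one (r : Fin 1 → ℝ) (z : Fin 1 → ℂ) (p : ℕ) (k : Fin 0 → ℕ) :
    scatTerm r z (Fin.cons p k) = (r 0 * z 0) ^ p := by
  simp [scatTerm, nextEntry, scatPoly_zero_right, mul_pow]

/-- The series of the norms of the terms with first index `p` grows subexponentially in `p`. -/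
theorem summable_norm_scatTerm (n : ℕ) (r : Fin (n + 1) → ℝ) (hr : ∀ j, |r j| ≤ 1)
    (z : Fin (n + 1) → ℂ) (hz : ∀ j, ‖z j‖ = 1) (M : ℝ) (hM : 1 < M) :
    ∃ C : ℝ, ∀ p : ℕ, Summable (fun k : Fin n → ℕ => ‖scatTerm r z (Fin.cons p k)‖) ∧
      ∑' k : Fin n → ℕ, ‖scatTerm r z (Fin.cons p k)‖ ≤ C * M ^ p := by
  induction n generalizing M with
  | zero =>
    refine ⟨1, fun p => ⟨.of_finite, ?_⟩⟩
    simp only [scatTerm_one, norm_pow, norm_mul, hz, mul_one, Complex.norm_real, Real.norm_eq_abs]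
    rw [tsum_fintype, Fintype.sum_unique, one_mul]
    exact pow_le_pow_left₀ (abs_nonneg _) ((hr 0).trans hM.le) p
  | succ n ih =>
    obtain ⟨R, hR, hb⟩ := exists_abs_scatPoly_le (hr 0) hM
    -- Taking growth rate `σ < R` for the inner sums makes the sum over `q` geometric with ratio `σ
    -- / R`; hence the induction over all `M > 1`.
    obtain ⟨σ, hσ, hσR⟩ := exists_between hR
    obtain ⟨C, hC⟩ := ih (fun j => r j.succ) (fun j => hr _) (fun j => z j.succ)
      (fun j => hz _) σ hσ
    have hR0 : 0 < R := by linarith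
    have hgeom : Summable fun q : ℕ => (σ / R) ^ q :=
      summable_geometric_of_lt_one (by positivity) ((div_lt_one hR0).2 hσR)
    refine ⟨C * ∑' q : ℕ, (σ / R) ^ q, fun p => ?_⟩
    let e := Fin.consEquiv (fun _ : Fin (n + 1) => ℕ)
    have hterm : ∀ (q : ℕ) (k : Fin n → ℕ),
        ‖scatTerm r z (Fin.cons p (e (q, k)))‖ = |scatPoly p q (r 0)| *
          ‖scatTerm (fun j => r j.succ) (fun j => z j.succ) (Fin.cons q k)‖ := fun q k => by
      change ‖scatTerm r z (Fin.cons p (Fin.cons q k : Fin (n + 1) → ℕ))‖ = _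
      rw [scatTerm_cons_cons, norm_mul, norm_mul, norm_pow, hz, one_pow, mul_one,
        Complex.norm_real, Real.norm_eq_abs]
    have hinner : ∀ q : ℕ, Summable fun k => ‖scatTerm r z (Fin.cons p (e (q, k)))‖ := fun q => by
      simp only [hterm]
      exact (hC q).1.mul_left _
    have hle : ∀ q : ℕ, ∑' k, ‖scatTerm r z (Fin.cons p (e (q, k)))‖ ≤
        C * M ^ p * (σ / R) ^ q := fun q => by
      simp only [hterm]
      rw [tsum_mul_left]
      calc _ ≤ M ^ p / R ^ q * (C * σ ^ q) :=
            mul_le_mul (hb p q) (hC q).2 (tsum_nonneg fun _ => norm_nonneg _) (by positivity)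
        _ = _ := by rw [div_pow]; ring
    have hmaj := hgeom.mul_left (C * M ^ p)
    have hout : Summable fun q : ℕ => ∑' k, ‖scatTerm r z (Fin.cons p (e (q, k)))‖ :=
      Summable.of_nonneg_of_le (fun q => tsum_nonneg fun _ => norm_nonneg _) hle hmaj
    have hsum : Summable fun x : ℕ × (Fin n → ℕ) => ‖scatTerm r z (Fin.cons p (e x))‖ :=
      (summable_prod_of_nonneg fun _ => norm_nonneg _).2 ⟨hinner, hout⟩
    refine ⟨(e.summable_iff (f := fun k => ‖scatTerm r z (Fin.cons p k)‖)).1 hsum, ?_⟩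
    rw [← e.tsum_eq (fun k => ‖scatTerm r z (Fin.cons p k)‖), hsum.tsum_prod]
    refine (hout.tsum_le_tsum hle hmaj).trans (le_of_eq ?_)
    rw [tsum_mul_left]
    ring

/-- All powers `p` are treated at once because expanding the outermost map calls for every power of
the inner composition. -/
theorem hasSum_scatTerm (n : ℕ) (r : Fin (n + 1) → ℝ) (hr : ∀ j, |r j| ≤ 1)
    (z : Fin (n + 1) → ℂ) (hz : ∀ j, ‖z j‖ = 1) (p : ℕ) :
    HasSum (fun k : Fin n → ℕ => scatTerm r z (Fin.cons p k))
      (Psi (fun j => (r j : ℂ)) z ^ p) := by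
  induction n generalizing p with
  | zero =>
    have h : Psi (fun j => (r j : ℂ)) z = r 0 * z 0 := by
      simp only [Psi, diskComp, Function.comp, diskMap, id]
      split_ifs
      · ring
      · simp [mul_comm]
    simp only [scatTerm_one, h]
    exact hasSum_unique _
  | succ n ih =>
    let e := Fin.consEquiv (fun _ : Fin (n + 1) => ℕ)
    obtain ⟨C, hC⟩ := summable_norm_scatTerm (n + 1) r hr z hz 2 one_lt_two
    have hs : Summable fun x : ℕ × (Fin n → ℕ) => scatTerm r z (Fin.cons p (e x)) :=
      (e.summable_iff (f := fun k => scatTerm r z (Fin.cons p k))).2 (hC p).1.of_norm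
    have hfib := hs.hasSum.prod_fiberwise (fun q => by
      change HasSum (fun k => scatTerm r z (Fin.cons p (Fin.cons q k : Fin (n + 1) → ℕ))) _
      simp only [scatTerm_cons_cons]
      exact (ih (fun j => r j.succ) (fun j => hr _) (fun j => z j.succ)
        (fun j => hz _) q).mul_left _)
    have hΨ := hasSum_diskMap_pow (hr 0) (z 0)
      (norm_Psi_le_one (fun j => r j.succ) (fun j => hr _) (fun j => z j.succ) fun j => hz _) p
    have hfin := hs.hasSum
    -- Summing over tails first leaves the one-variable series in `q`, which identifies the total.
    rw [hfib.unique hΨ] at hfin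
    exact (e.hasSum_iff (f := fun k => scatTerm r z (Fin.cons p k))).1 hfin

/-- Tuples of length `n + 1` with first entry `p` correspond to their tails. -/
def consFiberEquiv (n p : ℕ) : (Fin n → ℕ) ≃ {k : Fin (n + 1) → ℕ // k 0 = p} where
  toFun k := ⟨Fin.cons p k, Fin.cons_zero (α := fun _ => ℕ) p k⟩
  invFun k := Fin.tail k.1
  left_inv k := Fin.tail_cons (α := fun _ => ℕ) p k
  right_inv := by
    rintro ⟨k, rfl⟩
    exact Subtype.ext (Fin.cons_self_tail k)

end DiskComposition

/-- In `ℂ` unconditional and absolute summability agree, so `HasSum` includes absolute convergence.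
-/
theorem mainTheorem5 (n : ℕ) [NeZero n] (r : Fin n → ℝ) (hr : ∀ j, r j ∈ Set.Icc (-1 : ℝ) 1)
    (z : Fin n → Circle) :
    HasSum
      (fun k : {k : Fin n → ℕ // k 0 = 1} =>
        ((∏ j : Fin n,
            DiskComposition.scatPoly (k.1 j : ℤ) (DiskComposition.nextEntry k.1 j : ℤ) (r j) : ℝ) : ℂ) *
          ∏ j : Fin n, (z j : ℂ) ^ k.1 j)
      (DiskComposition.Psi (fun j => (r j : ℂ)) (fun j => (z j : ℂ))) := by
  obtain ⟨m, rfl⟩ := Nat.exists_eq_succ_of_ne_zero (NeZero.ne n)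
  have h := DiskComposition.hasSum_scatTerm m r (fun j => abs_le.2 (hr j)) (fun j => (z j : ℂ))
    (fun j => Circle.norm_coe _) 1
  rw [pow_one] at h
  exact (DiskComposition.consFiberEquiv m 1).hasSum_iff.1 h
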